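/- **Theorem 1.1.** For $m\in(0,1)$ let $$K(m)=\int_0^{\pi/2}\frac{d\theta}{\sqrt{1-m\sin^2\theta}},\qquad E(m)=\int_0^{\pi/2}\sqrt{1-m\sin^2\theta}\,d\theta$$ be the complete elliptic integrals of the first and second kind. There is a unique $m^*\in(0,1)$ with $K(m^*)=2E(m^*)$; put $$\varpi^*:=32\,(2m^*-1)\,E(m^*)^2 .$$ Let $n\ge 2$ and let $\gamma:\mathbf{R}/\mathbf{Z}\to\mathbf{R}^n$ be an immersed closed curve of Sobolev class $H^2=W^{2,2}$ (so that $\gamma$ is of class $C^1$, and immersed means $\gamma'\neq0$ everywhere). Let $s$ denote arclength, $\kappa=\partial_s^2\gamma$ the curvature vector, $L[\gamma]=\int_\gamma ds$ the length, and $$\bar B[\gamma]:=L[\gamma]\int_\gamma|\kappa|^2\,ds$$ the normalized bending energy. If $k\ge2$ is an integer and $\gamma$ has a point $p\in\mathbf{R}^n$ of multiplicity $k$, that is, the preimage $\gamma^{-1}(p)$ contains at least $k$ distinct points, then $$\bar B[\gamma]\ \ge\ \varpi^*k^2 .$$ In particular, if $\bar B[\gamma]<4\varpi^*$, then $\gamma$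 is embedded. -/

import Mathlib

open scoped ContDiff

noncomputable section

/-- The complete elliptic integral of the first kind `K(m)`, with parameter `m`
(the squared modulus). -/
def ellipticK (m : ℝ) : ℝ :=
  ∫ θ in (0 : ℝ)..(Real.pi / 2), 1 / Real.sqrt (1 - m * Real.sin θ ^ 2)

/-- The complete elliptic integral of the second kind `E(m)`, with parameter `m`
(the squared modulus). -/
def ellipticE (m : ℝ) : ℝ :=
  ∫ θ in (0 : ℝ)..(Real.pi / 2), Real.sqrt (1 - m * Real.sin θ ^ 2)

/-- The property `m ∈ (0,1)` and `K(m) = 2 E(m)` that determines the parameter `m*`. -/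
def IsMStar (m : ℝ) : Prop :=
  m ∈ Set.Ioo (0 : ℝ) 1 ∧ ellipticK m = 2 * ellipticE m

/-- `32 (2m - 1) E(m)²`; for `m = m*` this is the constant `ϖ*`. -/
def varpi (m : ℝ) : ℝ :=
  32 * (2 * m - 1) * ellipticE m ^ 2

/-- A function on the circle `𝐑/𝐙`, read as a `1`-periodic function of a real variable. -/
def periodicLift {F : Type*} (u : UnitAddCircle → F) : ℝ → F :=
  fun t => u (t : UnitAddCircle)

/-- `v` is the weak (distributional) derivative of `u` on the circle `𝐑/𝐙`: one has
`∫ φ' u = - ∫ φ v` for all smooth functions `φ` on the circle. -/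
def HasWeakDerivCircle {n : ℕ} (u v : UnitAddCircle → EuclideanSpace ℝ (Fin n)) : Prop :=
  ∀ φ : UnitAddCircle → ℝ, ContDiff ℝ ∞ (periodicLift φ) →
    ∫ t in (0 : ℝ)..1, deriv (periodicLift φ) t • periodicLift u t =
      -∫ t in (0 : ℝ)..1, periodicLift φ t • periodicLift v t

/-- Closed curves of Sobolev class `H² = W^{2,2}`: the curve (its continuous representative) has
weak first and second derivatives in `L²`. -/
def IsH2ClosedCurve {n : ℕ} (γ : UnitAddCircle → EuclideanSpace ℝ (Fin n)) : Prop :=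
  Continuous γ ∧
    ∃ v w : UnitAddCircle → EuclideanSpace ℝ (Fin n),
      MeasureTheory.MemLp v 2 MeasureTheory.volume ∧
      MeasureTheory.MemLp w 2 MeasureTheory.volume ∧
      HasWeakDerivCircle γ v ∧ HasWeakDerivCircle v w

/-- The velocity `γ'`. A closed curve of class `H²` is of class `C¹`, so for such curves this is
the classical derivative at every point. -/
def velocity {n : ℕ} (γ : UnitAddCircle → EuclideanSpace ℝ (Fin n)) (t : ℝ) :
    EuclideanSpace ℝ (Fin n) :=
  deriv (periodicLift γ) t

/-- Immersed closed curves of class `H²`: the velocity vanishes nowhere. -/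
def IsImmersedClosedCurve {n : ℕ} (γ : UnitAddCircle → EuclideanSpace ℝ (Fin n)) : Prop :=
  IsH2ClosedCurve γ ∧ ∀ t : ℝ, velocity γ t ≠ 0

/-- The unit tangent `T = ∂ₛ γ = γ' / |γ'|`. -/
def unitTangent {n : ℕ} (γ : UnitAddCircle → EuclideanSpace ℝ (Fin n)) (t : ℝ) :
    EuclideanSpace ℝ (Fin n) :=
  ‖velocity γ t‖⁻¹ • velocity γ t

/-- The curvature vector `κ = ∂ₛ² γ = ∂ₛ T`, where `∂ₛ = |γ'|⁻¹ d/dt`. For an immersed curve of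
class `H²` the unit tangent is absolutely continuous, so its derivative exists almost everywhere
and is its weak derivative. -/
def curvatureVector {n : ℕ} (γ : UnitAddCircle → EuclideanSpace ℝ (Fin n)) (t : ℝ) :
    EuclideanSpace ℝ (Fin n) :=
  ‖velocity γ t‖⁻¹ • deriv (unitTangent γ) t

/-- The length `L[γ] = ∫_γ ds`, where `ds = |γ'| dt`. -/
def curveLength {n : ℕ} (γ : UnitAddCircle → EuclideanSpace ℝ (Fin n)) : ℝ :=
  ∫ t in (0 : ℝ)..1, ‖velocity γ t‖

/-- The bending energy `B[γ] = ∫_γ |κ|² ds`. -/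
def bendingEnergy {n : ℕ} (γ : UnitAddCircle → EuclideanSpace ℝ (Fin n)) : ℝ :=
  ∫ t in (0 : ℝ)..1, ‖curvatureVector γ t‖ ^ 2 * ‖velocity γ t‖

/-- The normalized bending energy `L[γ] B[γ]`. -/
def normalizedBendingEnergy {n : ℕ} (γ : UnitAddCircle → EuclideanSpace ℝ (Fin n)) : ℝ :=
  curveLength γ * bendingEnergy γ

/-- `p` is a point of multiplicity `k` of `γ`: the preimage of `p` contains at least `k` distinct
points. -/
def HasPointOfMultiplicity {n : ℕ} (γ : UnitAddCircle → EuclideanSpace ℝ (Fin n))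
    (p : EuclideanSpace ℝ (Fin n)) (k : ℕ) : Prop :=
  (k : ℕ∞) ≤ (γ ⁻¹' {p}).encard

end

/-!
Everything reduces to one inequality: a closed loop, with no condition on the tangents at its base
point, satisfies `L B ≥ ϖ*` (`IsImmersedVelocity.varpi_div_le_integral_bendingDensity`). A point of
multiplicity `k` cuts a closed curve into `k` such loops, and the Cauchy-Schwarz inequality
`(∑ Lᵢ) (∑ Bᵢ) ≥ (∑ √(Lᵢ Bᵢ))²` gives the factor `k²`.

The loop inequality is proved without compactness or the elastica equation. Let `e` be the unit
tangent at the midpoint of the loop and `θ` the angle between `e` and the unit tangent `T`, so that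
`|θ'| ≤ |κ|`. The loop is closed, so `∫ cos θ ds = 0`. On each half let `M` be the largest value of
`θ`. For every `r ≥ 0`, Young's inequality gives
`∫ |κ|² + r² (cos θ - cos M) ds ≥ 2 r ∫ |θ'| √(cos θ - cos M) ds ≥ 2 r G(M)` with
`G(M) = ∫₀ᴹ √(cos x - cos M) dx`, because `θ` runs from `0` to `M`. The substitution
`sin (x / 2) = sin (M / 2) sin φ` turns `G(M)` into `2 √2 Φ(m)` with `m = sin² (M / 2)` and
`Φ(m) = ∫ m cos² φ / √(1 - m sin² φ) dφ = E(m) - (1 - m) K(m)`, a convex function of `m` with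
`Φ' = K / 2`. The tangent of `Φ` at `m*` and `r = 2 √2 K(m*) / L` give a bound in which `m` cancels
(`cos M = 1 - 2 m`). Adding the two halves, the terms with `∫ cos θ ds` cancel as well, and
`K(m*) = 2 E(m*)` turns the bound into `ϖ* / L`.

The regularity theory comes from the du Bois-Reymond lemma on the circle: the weak derivatives of an
`H²` curve give a continuous velocity that is the primitive of an `L²` function. Hence `θ` is
absolutely continuous, and its derivative exists almost everywhere and integrates to its increments.
-/

/-! ### Complete elliptic integrals and the pendulum action -/

theorem one_sub_mul_sin_sq_pos {m : ℝ} (hm : m < 1) (θ : ℝ) : 0 < 1 - m * Real.sin θ ^ 2 := by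
  rcases le_or_gt m 0 with h | h
  · nlinarith [sq_nonneg (Real.sin θ)]
  · nlinarith [Real.sin_sq_le_one θ]

theorem continuous_ellipticK_integrand {m : ℝ} (hm : m < 1) :
    Continuous fun θ => 1 / Real.sqrt (1 - m * Real.sin θ ^ 2) :=
  continuous_const.div (by fun_prop) fun θ =>
    (Real.sqrt_pos.2 (one_sub_mul_sin_sq_pos hm θ)).ne'

theorem ellipticK_pos {m : ℝ} (hm : m < 1) : 0 < ellipticK m := by
  refine intervalIntegral.intervalIntegral_pos_of_pos
    ((continuous_ellipticK_integrand hm).intervalIntegrable _ _) (fun θ => ?_) (by positivity)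
  have := Real.sqrt_pos.2 (one_sub_mul_sin_sq_pos hm θ)
  positivity

theorem ellipticK_strictMonoOn : StrictMonoOn ellipticK (Set.Ioo 0 1) := by
  intro a ha b hb hab
  refine intervalIntegral.integral_lt_integral_of_continuousOn_of_le_of_exists_lt
    (by positivity) (continuous_ellipticK_integrand ha.2).continuousOn
    (continuous_ellipticK_integrand hb.2).continuousOn (fun θ _ => ?_)
    ⟨Real.pi / 2, ⟨by positivity, le_rfl⟩, ?_⟩
  · have h1 := one_sub_mul_sin_sq_pos hb.2 θ
    have h2 := Real.sqrt_pos.2 h1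
    gcongr
  · have h1 := one_sub_mul_sin_sq_pos hb.2 (Real.pi / 2)
    have h2 := Real.sqrt_pos.2 h1
    rw [Real.sin_pi_div_two] at *
    gcongr

theorem ellipticE_antitone : Antitone ellipticE := by
  intro a b hab
  refine intervalIntegral.integral_mono_on (by positivity)
    (Continuous.intervalIntegrable (by fun_prop) _ _)
    (Continuous.intervalIntegrable (by fun_prop) _ _) (fun θ _ => ?_)
  gcongr

theorem ellipticE_le {m : ℝ} (hm : 0 ≤ m) : ellipticE m ≤ Real.pi / 2 := by
  have := ellipticE_antitone hm
  simpa [ellipticE] using this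

/-- `K(m)` grows at least like `-½ log (1 - m)` as `m → 1`. -/
theorem neg_log_le_ellipticK {ε : ℝ} (hε : 0 < ε) : -Real.log ε ≤ ellipticK (1 - ε ^ 2) := by
  have hm : 1 - ε ^ 2 < 1 := by nlinarith
  have hpi : 1 ≤ Real.pi / 2 := by linarith [Real.pi_gt_three]
  have hint : ∫ θ in (0 : ℝ)..(Real.pi / 2), 1 / (ε + (Real.pi / 2 - θ)) =
      Real.log ((ε + Real.pi / 2) / ε) := by
    have := intervalIntegral.integral_comp_sub_left (a := 0) (b := Real.pi / 2)
      (fun x => 1 / x) (ε + Real.pi / 2)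
    simp only [add_sub_assoc] at this
    rw [this]
    simp only [sub_self, add_zero, sub_zero]
    rw [integral_one_div_of_pos hε (by positivity)]
  calc -Real.log ε = Real.log (1 / ε) := by rw [one_div, Real.log_inv]
    _ ≤ Real.log ((ε + Real.pi / 2) / ε) := by
        apply Real.log_le_log (by positivity)
        gcongr
        linarith
    _ ≤ ellipticK (1 - ε ^ 2) := by
        rw [← hint]
        refine intervalIntegral.integral_mono_on (by positivity) ?_
          ((continuous_ellipticK_integrand hm).intervalIntegrable _ _) (fun θ hθ => ?_)
        · refine ContinuousOn.intervalIntegrable ?_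
          refine continuousOn_const.div (by fun_prop) fun θ hθ => ?_
          rw [Set.uIcc_of_le (by positivity)] at hθ
          linarith [hθ.2]
        · have h1 := Real.sqrt_pos.2 (one_sub_mul_sin_sq_pos hm θ)
          have h0 : 0 ≤ Real.pi / 2 - θ := by linarith [hθ.2]
          have hc : Real.cos θ ≤ Real.pi / 2 - θ := by
            rw [← Real.sin_pi_div_two_sub]; exact Real.sin_le h0
          have hc0 : 0 ≤ Real.cos θ := Real.cos_nonneg_of_mem_Icc ⟨by linarith [hθ.1], hθ.2⟩
          refine one_div_le_one_div_of_le h1 (Real.sqrt_le_iff.2 ⟨by linarith, ?_⟩)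
          nlinarith [Real.sin_sq_add_cos_sq θ, Real.cos_sq_le_one θ, mul_nonneg hε.le h0,
            mul_nonneg (sq_nonneg ε) (sq_nonneg (Real.cos θ))]

theorem continuous_ellipticK_comp_min {b : ℝ} (hb : b < 1) :
    Continuous fun m => ellipticK (min m b) := by
  unfold ellipticK
  refine intervalIntegral.continuous_parametric_intervalIntegral_of_continuous'
    (f := fun m θ => 1 / Real.sqrt (1 - min m b * Real.sin θ ^ 2)) ?_ _ _
  refine continuous_const.div (by fun_prop) fun p => ?_
  exact (Real.sqrt_pos.2 (one_sub_mul_sin_sq_pos ((min_le_right _ _).trans_lt hb) _)).ne'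

theorem continuous_ellipticE : Continuous ellipticE := by
  unfold ellipticE
  exact intervalIntegral.continuous_parametric_intervalIntegral_of_continuous'
    (f := fun m θ => Real.sqrt (1 - m * Real.sin θ ^ 2)) (by fun_prop) _ _

theorem existsUnique_isMStar : ∃! m : ℝ, IsMStar m := by
  refine existsUnique_of_exists_of_unique ?_ ?_
  · -- `-log ε = 4` exceeds `π`, an upper bound for `2 E`.
    set ε := Real.exp (-4) with hε
    have hε0 : 0 < ε := Real.exp_pos _
    have hε1 : ε < 1 := by rw [hε, Real.exp_lt_one_iff]; norm_num
    set b := 1 - ε ^ 2 with hb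
    have hb1 : b < 1 := by nlinarith
    have hb0 : 0 < b := by nlinarith
    have hcont : Continuous fun m => ellipticK (min m b) - 2 * ellipticE m :=
      (continuous_ellipticK_comp_min hb1).sub (continuous_const.mul continuous_ellipticE)
    have hK : 4 ≤ ellipticK b := by
      have := neg_log_le_ellipticK hε0
      rwa [hε, Real.log_exp, neg_neg] at this
    have hmem : (0 : ℝ) ∈ Set.Ioo (ellipticK (min 0 b) - 2 * ellipticE 0)
        (ellipticK (min b b) - 2 * ellipticE b) := by
      constructor
      · rw [min_eq_left hb0.le]
        simp only [ellipticK, ellipticE, zero_mul, sub_zero, Real.sqrt_one]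
        simp
        linarith [Real.pi_pos]
      · rw [min_self]
        linarith [ellipticE_le hb0.le, Real.pi_lt_four]
    obtain ⟨m, hm, hm0⟩ := intermediate_value_Ioo hb0.le hcont.continuousOn hmem
    refine ⟨m, ⟨hm.1, hm.2.trans hb1⟩, ?_⟩
    simp only [min_eq_left hm.2.le] at hm0
    linarith
  · have key : ∀ a b : ℝ, IsMStar a → IsMStar b → ¬ a < b := fun a b ha hb hab => by
      linarith [ellipticK_strictMonoOn ha.1 hb.1 hab, ellipticE_antitone hab.le, ha.2, hb.2]
    intro a b ha hb
    exact le_antisymm (not_lt.1 (key _ _ hb ha)) (not_lt.1 (key _ _ ha hb))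

/-- The function `x ↦ x / √(1 - s x)` lies above its tangent at `x₀`. -/
theorem tangent_le_div_sqrt {s x x₀ : ℝ} (hs : 0 < s) (hx : s * x < 1) (hx₀ : s * x₀ < 1) :
    x₀ / Real.sqrt (1 - s * x₀) +
      (x - x₀) * ((1 - s * x₀ / 2) / Real.sqrt (1 - s * x₀) ^ 3) ≤
      x / Real.sqrt (1 - s * x) := by
  have hA := Real.sqrt_pos.2 (sub_pos.2 hx)
  have hB := Real.sqrt_pos.2 (sub_pos.2 hx₀)
  have hA2 := Real.sq_sqrt (sub_pos.2 hx).le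
  have hB2 := Real.sq_sqrt (sub_pos.2 hx₀).le
  set A := Real.sqrt (1 - s * x)
  set B := Real.sqrt (1 - s * x₀)
  have ex : x = (1 - A ^ 2) / s := by rw [hA2]; field_simp; ring
  have ex₀ : x₀ = (1 - B ^ 2) / s := by rw [hB2]; field_simp; ring
  rw [ex, ex₀]
  have : (1 - A ^ 2) / s / A - ((1 - B ^ 2) / s / B +
      ((1 - A ^ 2) / s - (1 - B ^ 2) / s) * ((1 - s * ((1 - B ^ 2) / s) / 2) / B ^ 3)) =
      (B - A) ^ 2 * (2 * B + A + A * B ^ 2) / (2 * s * A * B ^ 3) := by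
    field_simp
    ring
  have h2 : 0 ≤ (B - A) ^ 2 * (2 * B + A + A * B ^ 2) / (2 * s * A * B ^ 3) := by positivity
  linarith

/-- `∫ m cos² / √(1 - m sin²) = E - (1 - m) K`. -/
theorem integral_cos_sq_div_sqrt {m : ℝ} (hm : m < 1) :
    ∫ φ in (0 : ℝ)..(Real.pi / 2), m * Real.cos φ ^ 2 / Real.sqrt (1 - m * Real.sin φ ^ 2) =
      ellipticE m - (1 - m) * ellipticK m := by
  rw [ellipticE, ellipticK, ← intervalIntegral.integral_const_mul,
    ← intervalIntegral.integral_sub (Continuous.intervalIntegrable (by fun_prop) _ _)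
      (((continuous_ellipticK_integrand hm).intervalIntegrable _ _).const_mul _)]
  refine intervalIntegral.integral_congr fun φ _ => ?_
  have h := one_sub_mul_sin_sq_pos hm φ
  have h1 := Real.sqrt_pos.2 h
  have h2 := Real.sq_sqrt h.le
  field_simp
  rw [h2]
  linear_combination m * Real.sin_sq_add_cos_sq φ

/-- The `m`-derivative of `m cos² / √(1 - m sin²)` integrates to `K / 2`: it differs from half the
integrand of `K` by the derivative of `sin cos / (2 √(1 - m sin²))`. -/
theorem integral_deriv_cos_sq_div_sqrt {m : ℝ} (hm : m < 1) :
    IntervalIntegrable (fun φ => Real.cos φ ^ 2 * ((1 - Real.sin φ ^ 2 * m / 2) /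
        Real.sqrt (1 - Real.sin φ ^ 2 * m) ^ 3)) MeasureTheory.volume 0 (Real.pi / 2) ∧
    ∫ φ in (0 : ℝ)..(Real.pi / 2), Real.cos φ ^ 2 * ((1 - Real.sin φ ^ 2 * m / 2) /
        Real.sqrt (1 - Real.sin φ ^ 2 * m) ^ 3) = ellipticK m / 2 := by
  have hpos : ∀ φ, 0 < Real.sqrt (1 - Real.sin φ ^ 2 * m) := fun φ => by
    rw [mul_comm]; exact Real.sqrt_pos.2 (one_sub_mul_sin_sq_pos hm φ)
  have hcont : Continuous fun φ => Real.cos φ ^ 2 * ((1 - Real.sin φ ^ 2 * m / 2) /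
        Real.sqrt (1 - Real.sin φ ^ 2 * m) ^ 3) := by
    refine Continuous.mul (by fun_prop) (Continuous.div (by fun_prop) (by fun_prop) fun φ => ?_)
    exact (pow_pos (hpos φ) 3).ne'
  refine ⟨hcont.intervalIntegrable _ _, ?_⟩
  have hd : ∀ φ ∈ Set.uIcc 0 (Real.pi / 2), HasDerivAt
      (fun φ => Real.sin φ * Real.cos φ / (2 * Real.sqrt (1 - Real.sin φ ^ 2 * m)))
      (Real.cos φ ^ 2 * ((1 - Real.sin φ ^ 2 * m / 2) /
        Real.sqrt (1 - Real.sin φ ^ 2 * m) ^ 3) -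
        1 / 2 * (1 / Real.sqrt (1 - m * Real.sin φ ^ 2))) φ := by
    intro φ _
    have h1 : HasDerivAt (fun φ => 1 - Real.sin φ ^ 2 * m)
        (-(2 * Real.sin φ * Real.cos φ * m)) φ := by
      refine ((((Real.hasDerivAt_sin φ).pow 2).mul_const m).const_sub 1).congr_deriv ?_
      norm_num
    have hp := hpos φ
    have h2 := h1.sqrt (Real.sqrt_pos.1 hp).ne'
    have h3 := ((Real.hasDerivAt_sin φ).mul (Real.hasDerivAt_cos φ)).div (h2.const_mul 2)
      (by positivity)
    refine h3.congr_deriv ?_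
    rw [mul_comm m]
    have hsq := Real.sq_sqrt (Real.sqrt_pos.1 hp).le
    set B := Real.sqrt (1 - Real.sin φ ^ 2 * m)
    have hc := Real.sin_sq_add_cos_sq φ
    simp only [Pi.mul_apply]
    field_simp
    have hc' : Real.cos φ ^ 2 = 1 - Real.sin φ ^ 2 := by linarith
    rw [hc']
    linear_combination (2 - 2 * Real.sin φ ^ 2) * hsq
  have hK := (continuous_ellipticK_integrand hm).intervalIntegrable (μ := MeasureTheory.volume)
    0 (Real.pi / 2)
  have := intervalIntegral.integral_eq_sub_of_hasDerivAt hd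
    ((hcont.intervalIntegrable _ _).sub (hK.const_mul _))
  rw [intervalIntegral.integral_sub (hcont.intervalIntegrable _ _) (hK.const_mul _),
    intervalIntegral.integral_const_mul] at this
  simp only [Real.cos_pi_div_two, Real.sin_zero, mul_zero, zero_mul, zero_div, sub_self] at this
  rw [ellipticK]
  linarith

/-- Convexity in `m` of `∫ m cos² / √(1 - m sin²)`, including the endpoint `m = 1`: the tangent at
`m₀` has slope `K(m₀) / 2`. -/
theorem tangent_le_integral_cos_sq_div_sqrt {m m₀ : ℝ} (hm : m ≤ 1) (hm₀ : m₀ < 1)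
    (hint : IntervalIntegrable (fun φ => m * Real.cos φ ^ 2 / Real.sqrt (1 - m * Real.sin φ ^ 2))
      MeasureTheory.volume 0 (Real.pi / 2)) :
    ellipticE m₀ - (1 - m₀) * ellipticK m₀ + (m - m₀) * (ellipticK m₀ / 2) ≤
      ∫ φ in (0 : ℝ)..(Real.pi / 2), m * Real.cos φ ^ 2 / Real.sqrt (1 - m * Real.sin φ ^ 2) := by
  obtain ⟨hd, hd'⟩ := integral_deriv_cos_sq_div_sqrt hm₀
  have hc : IntervalIntegrable (fun φ => m₀ * Real.cos φ ^ 2 / Real.sqrt (1 - m₀ * Real.sin φ ^ 2))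
      MeasureTheory.volume 0 (Real.pi / 2) := by
    refine Continuous.intervalIntegrable (Continuous.div (by fun_prop) (by fun_prop) fun φ => ?_) _ _
    exact (Real.sqrt_pos.2 (one_sub_mul_sin_sq_pos hm₀ φ)).ne'
  rw [← integral_cos_sq_div_sqrt hm₀, ← hd', ← intervalIntegral.integral_const_mul,
    ← intervalIntegral.integral_add hc (hd.const_mul _)]
  refine intervalIntegral.integral_mono_on_of_le_Ioo (by positivity) (hc.add (hd.const_mul _)) hint
    fun φ hφ => ?_
  have hs : 0 < Real.sin φ := Real.sin_pos_of_pos_of_lt_pi hφ.1 (by linarith [hφ.2, Real.pi_pos])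
  have hcos : 0 < Real.cos φ := Real.cos_pos_of_mem_Ioo ⟨by linarith [hφ.1, Real.pi_pos], hφ.2⟩
  have h1 : Real.sin φ ^ 2 * m < 1 := by
    nlinarith [Real.sin_sq_add_cos_sq φ, pow_pos hcos 2, pow_pos hs 2]
  have h2 : Real.sin φ ^ 2 * m₀ < 1 := by linarith [one_sub_mul_sin_sq_pos hm₀ φ]
  have := mul_le_mul_of_nonneg_left (tangent_le_div_sqrt (pow_pos hs 2) h1 h2)
    (sq_nonneg (Real.cos φ))
  rw [mul_comm m (Real.sin φ ^ 2), mul_comm m₀ (Real.sin φ ^ 2)]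
  calc _ = _ := ?_
    _ ≤ _ := this
    _ = _ := ?_
  all_goals ring

/-- The substitution `θ = 2 arcsin (sin (M / 2) sin φ)` in the action integral of the pendulum of
amplitude `M`. -/
theorem integral_sqrt_cos_sub_cos {M : ℝ} (hM : M ∈ Set.Icc 0 Real.pi) :
    IntervalIntegrable (fun φ => Real.sin (M / 2) ^ 2 * Real.cos φ ^ 2 /
      Real.sqrt (1 - Real.sin (M / 2) ^ 2 * Real.sin φ ^ 2)) MeasureTheory.volume 0 (Real.pi / 2) ∧
    ∫ θ in (0 : ℝ)..M, Real.sqrt (Real.cos θ - Real.cos M) =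
      2 * Real.sqrt 2 * ∫ φ in (0 : ℝ)..(Real.pi / 2), Real.sin (M / 2) ^ 2 * Real.cos φ ^ 2 /
        Real.sqrt (1 - Real.sin (M / 2) ^ 2 * Real.sin φ ^ 2) := by
  have hMh : M / 2 ∈ Set.Icc (-(Real.pi / 2)) (Real.pi / 2) :=
    ⟨by linarith [hM.1, Real.pi_pos], by linarith [hM.2]⟩
  have hk0 : 0 ≤ Real.sin (M / 2) :=
    Real.sin_nonneg_of_nonneg_of_le_pi (by linarith [hM.1]) (by linarith [hM.2, Real.pi_pos])
  have hk1 : Real.sin (M / 2) ≤ 1 := Real.sin_le_one _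
  have hcosM : Real.cos M = 1 - 2 * Real.sin (M / 2) ^ 2 := by
    have h2 := Real.cos_sq (M / 2)
    rw [mul_div_cancel₀ _ two_ne_zero] at h2
    linarith [Real.sin_sq_add_cos_sq (M / 2)]
  set k := Real.sin (M / 2) with hk
  have hpi : (0 : ℝ) ≤ Real.pi / 2 := by positivity
  have hint : IntervalIntegrable (fun φ => k ^ 2 * Real.cos φ ^ 2 /
      Real.sqrt (1 - k ^ 2 * Real.sin φ ^ 2)) MeasureTheory.volume 0 (Real.pi / 2) := by
    refine (intervalIntegrable_const (c := (1 : ℝ))).mono_fun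
      (Measurable.aestronglyMeasurable (by fun_prop)) (Filter.Eventually.of_forall fun φ => ?_)
    beta_reduce
    rw [Real.norm_of_nonneg (by positivity), norm_one]
    refine div_le_one_of_le₀ (Real.le_sqrt_of_sq_le ?_) (Real.sqrt_nonneg _)
    have hc := Real.sin_sq_add_cos_sq φ
    have h1 : k ^ 2 ≤ 1 := by nlinarith
    have h2 : k ^ 2 * Real.cos φ ^ 2 ≤ 1 := by
      nlinarith [sq_nonneg (Real.sin φ), sq_nonneg (Real.cos φ)]
    calc (k ^ 2 * Real.cos φ ^ 2) ^ 2 ≤ k ^ 2 * Real.cos φ ^ 2 := by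
          rw [sq]; exact mul_le_of_le_one_left (by positivity) h2
      _ ≤ 1 - k ^ 2 * Real.sin φ ^ 2 := by nlinarith
  refine ⟨hint, ?_⟩
  have heq : Set.EqOn (fun φ => ((fun θ => Real.sqrt (Real.cos θ - Real.cos M)) ∘
      fun φ => 2 * Real.arcsin (k * Real.sin φ)) φ *
        (2 * (k * Real.cos φ / Real.sqrt (1 - (k * Real.sin φ) ^ 2))))
      (fun φ => 2 * Real.sqrt 2 * (k ^ 2 * Real.cos φ ^ 2 /
        Real.sqrt (1 - k ^ 2 * Real.sin φ ^ 2))) (Set.Icc 0 (Real.pi / 2)) := by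
    intro φ hφ
    have hs0 : 0 ≤ Real.sin φ :=
      Real.sin_nonneg_of_nonneg_of_le_pi hφ.1 (by linarith [hφ.2, Real.pi_pos])
    have hcos : 0 ≤ Real.cos φ :=
      Real.cos_nonneg_of_mem_Icc ⟨by linarith [hφ.1, Real.pi_pos], hφ.2⟩
    have h1 : k * Real.sin φ ≤ 1 := mul_le_one₀ hk1 hs0 (Real.sin_le_one φ)
    have h2 : -1 ≤ k * Real.sin φ := by linarith [mul_nonneg hk0 hs0]
    have hval : Real.cos (2 * Real.arcsin (k * Real.sin φ)) - Real.cos M =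
        2 * (k * Real.cos φ) ^ 2 := by
      rw [Real.cos_two_mul, Real.cos_sq', Real.sin_arcsin h2 h1, hcosM]
      linear_combination (-2 * k ^ 2) * Real.sin_sq_add_cos_sq φ
    simp only [Function.comp]
    rw [hval, Real.sqrt_mul (by norm_num), Real.sqrt_sq (by positivity), mul_pow k (Real.sin φ)]
    ring
  have hsub := intervalIntegral.integral_comp_mul_deriv''' (a := 0) (b := Real.pi / 2)
    (f := fun φ => 2 * Real.arcsin (k * Real.sin φ))
    (f' := fun φ => 2 * (k * Real.cos φ / Real.sqrt (1 - (k * Real.sin φ) ^ 2)))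
    (g := fun θ => Real.sqrt (Real.cos θ - Real.cos M)) (by fun_prop) ?_
    (by fun_prop) ?_ ?_
  · simp only [Real.sin_zero, mul_zero, Real.arcsin_zero, Real.sin_pi_div_two, mul_one] at hsub
    rw [hk, Real.arcsin_sin hMh.1 hMh.2, mul_div_cancel₀ _ two_ne_zero] at hsub
    rw [← hsub, ← intervalIntegral.integral_const_mul]
    refine intervalIntegral.integral_congr fun φ hφ => ?_
    rw [Set.uIcc_of_le hpi] at hφ
    exact heq hφ
  · intro φ hφ
    rw [min_eq_left hpi, max_eq_right hpi] at hφ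
    have hs0 : 0 ≤ Real.sin φ :=
      Real.sin_nonneg_of_nonneg_of_le_pi hφ.1.le (by linarith [hφ.2, Real.pi_pos])
    have hcos : 0 < Real.cos φ :=
      Real.cos_pos_of_mem_Ioo ⟨by linarith [hφ.1, Real.pi_pos], hφ.2⟩
    have hs1 : Real.sin φ < 1 := by
      nlinarith [Real.sin_sq_add_cos_sq φ, pow_pos hcos 2]
    have h1 : k * Real.sin φ < 1 := by nlinarith
    have h2 : -1 < k * Real.sin φ := by nlinarith [mul_nonneg hk0 hs0]
    have hd := ((Real.hasDerivAt_arcsin h2.ne' h1.ne).comp φ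
      ((Real.hasDerivAt_sin φ).const_mul k)).const_mul 2
    refine HasDerivAt.hasDerivWithinAt (hd.congr_deriv ?_)
    ring
  · exact ContinuousOn.integrableOn_compact
      (isCompact_uIcc.image_of_continuousOn (by fun_prop)) (by fun_prop)
  · rw [Set.uIcc_of_le hpi]
    rw [intervalIntegrable_iff_integrableOn_Icc_of_le hpi] at hint
    exact MeasureTheory.IntegrableOn.congr_fun (hint.const_mul (2 * Real.sqrt 2))
      (fun φ hφ => (heq hφ).symm) measurableSet_Icc

theorem tangent_le_integral_sqrt_cos_sub_cos {M m₀ : ℝ} (hM : M ∈ Set.Icc 0 Real.pi)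
    (hm₀ : m₀ < 1) :
    2 * Real.sqrt 2 * (ellipticE m₀ - (1 - m₀) * ellipticK m₀ +
      ((1 - Real.cos M) / 2 - m₀) * (ellipticK m₀ / 2)) ≤
      ∫ θ in (0 : ℝ)..M, Real.sqrt (Real.cos θ - Real.cos M) := by
  obtain ⟨hint, h⟩ := integral_sqrt_cos_sub_cos hM
  rw [h]
  have hc : (1 - Real.cos M) / 2 = Real.sin (M / 2) ^ 2 := by
    have h1 := Real.cos_sq' (M / 2)
    have h2 := Real.cos_sq (M / 2)
    rw [mul_div_cancel₀ _ two_ne_zero] at h2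
    linarith
  rw [hc]
  gcongr
  exact tangent_le_integral_cos_sq_div_sqrt (Real.sin_sq_le_one _) hm₀ hint

open MeasureTheory Set

/-! ### Weak derivatives on the circle -/

section WeakDerivatives

/-- Periodizing a smooth function supported inside one period gives a smooth function. -/
theorem contDiff_comp_fract {g : ℝ → ℝ} (hg : ContDiff ℝ ∞ g) (hs : tsupport g ⊆ Ioo 0 1) :
    ContDiff ℝ ∞ fun t => g (Int.fract t) := by
  rw [contDiff_iff_contDiffAt]
  intro x
  rcases (Int.fract_nonneg x).eq_or_lt with h0 | h0
  · -- at an integer the periodization vanishes nearby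
    have hx : x = ⌊x⌋ := by have := Int.self_sub_floor x; linarith
    have hK : IsOpen (tsupport g)ᶜ := (isClosed_tsupport g).isOpen_compl
    have e0 : ∀ᶠ t : ℝ in nhds x, t - ⌊x⌋ ∈ (tsupport g)ᶜ := by
      refine (continuous_id.sub continuous_const).continuousAt.eventually (hK.mem_nhds ?_)
      intro h
      have : 0 < x - ⌊x⌋ := (hs h).1
      linarith
    have e1 : ∀ᶠ t : ℝ in nhds x, t - ⌊x⌋ + 1 ∈ (tsupport g)ᶜ := by
      refine ((continuous_id.sub continuous_const).add continuous_const).continuousAt.eventually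
        (hK.mem_nhds ?_)
      intro h
      have : x - ⌊x⌋ + 1 < 1 := (hs h).2
      linarith
    have e2 : ∀ᶠ t in nhds x, t ∈ Ioo (x - 1) (x + 1) := Ioo_mem_nhds (by linarith) (by linarith)
    refine (contDiffAt_const (c := (0 : ℝ))).congr_of_eventuallyEq ?_
    filter_upwards [e0, e1, e2] with t h0 h1 h2
    rcases lt_or_ge t x with h | h
    · have : ⌊t⌋ = ⌊x⌋ - 1 := by
        rw [Int.floor_eq_iff]; push_cast; constructor <;> linarith [h2.1]
      have e : Int.fract t = t - ⌊x⌋ + 1 := by rw [Int.fract, this]; push_cast; ring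
      rw [e]; exact image_eq_zero_of_notMem_tsupport h1
    · have : ⌊t⌋ = ⌊x⌋ := by
        rw [Int.floor_eq_iff]; constructor <;> linarith [h2.2]
      rw [Int.fract, this]; exact image_eq_zero_of_notMem_tsupport h0
  · have e : ∀ᶠ t in nhds x, t ∈ Ioo (⌊x⌋ : ℝ) (⌊x⌋ + 1) := by
      refine Ioo_mem_nhds ?_ (Int.lt_floor_add_one x)
      have := Int.self_sub_floor x; linarith
    refine ContDiffAt.congr_of_eventuallyEq (f := fun t => g (t - ⌊x⌋))
      (hg.comp (contDiff_id.sub contDiff_const)).contDiffAt ?_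
    filter_upwards [e] with t ht
    have : ⌊t⌋ = ⌊x⌋ := by
      rw [Int.floor_eq_iff]; exact ⟨ht.1.le, ht.2⟩
    rw [Int.fract, this]

/-- The du Bois-Reymond lemma on the circle. -/
theorem ae_eq_integral_of_integral_deriv_mul_eq_zero {h : ℝ → ℝ}
    (hint : IntervalIntegrable h volume 0 1)
    (H : ∀ φ : UnitAddCircle → ℝ, ContDiff ℝ ∞ (periodicLift φ) →
      ∫ t in (0 : ℝ)..1, deriv (periodicLift φ) t * h t = 0) :
    ∀ᵐ t, t ∈ Ioo (0 : ℝ) 1 → h t = ∫ s in (0 : ℝ)..1, h s := by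
  set c := ∫ s in (0 : ℝ)..1, h s with hc
  have hint' : IntegrableOn (fun t => h t - c) (Ioc 0 1) :=
    ((intervalIntegrable_iff_integrableOn_Ioc_of_le zero_le_one).1 hint).sub (by simp)
  have key := isOpen_Ioo.ae_eq_zero_of_integral_contDiff_smul_eq_zero (U := Ioo (0 : ℝ) 1)
    (μ := volume) (f := fun t => h t - c)
    (hint'.mono_set Ioo_subset_Ioc_self).locallyIntegrableOn ?_
  · filter_upwards [key] with t ht hmem
    linarith [ht hmem]
  intro g hg hcomp hs
  set c₀ := ∫ s in (0 : ℝ)..1, g s with hc₀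
  have hP : ContDiff ℝ ∞ fun t => g (Int.fract t) - c₀ :=
    (contDiff_comp_fract hg hs).sub contDiff_const
  have hper : Function.Periodic (fun t => g (Int.fract t) - c₀) 1 := fun t => by
    simp only [Int.fract_add_one]
  have hII : ∀ a b, IntervalIntegrable (fun t => g (Int.fract t) - c₀) volume a b :=
    fun a b => hP.continuous.intervalIntegrable a b
  have hfr : ∀ t ∈ Ioo (0 : ℝ) 1, Int.fract t = t := fun t ht =>
    Int.fract_eq_self.2 ⟨ht.1.le, ht.2⟩
  have hae : ∀ᵐ t : ℝ, t ≠ 1 := by simp [ae_iff, measure_singleton]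
  have hzero : ∫ t in (0 : ℝ)..1, (g (Int.fract t) - c₀) = 0 := by
    have : ∫ t in (0 : ℝ)..1, (g (Int.fract t) - c₀) = ∫ t in (0 : ℝ)..1, (g t - c₀) := by
      refine intervalIntegral.integral_congr_ae ?_
      filter_upwards [hae] with t ht1 ht
      rw [uIoc_of_le zero_le_one] at ht
      rw [hfr t ⟨ht.1, lt_of_le_of_ne ht.2 ht1⟩]
    rw [this, intervalIntegral.integral_sub (hg.continuous.intervalIntegrable _ _) (by simp)]
    simp [hc₀]
  -- the test function `Φ` has derivative `g - c₀` on one period; subtracting the mean `c₀` makes it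
  -- periodic
  set Φ : ℝ → ℝ := fun t => ∫ s in (0 : ℝ)..t, (g (Int.fract s) - c₀) with hΦ
  have hΦd : ∀ t, HasDerivAt Φ (g (Int.fract t) - c₀) t := fun t =>
    intervalIntegral.integral_hasDerivAt_right (hII _ _)
      (hP.continuous.stronglyMeasurableAtFilter _ _) hP.continuous.continuousAt
  have hΦp : Function.Periodic Φ 1 := fun t => by
    simp only [hΦ]
    rw [← intervalIntegral.integral_add_adjacent_intervals (hII 0 t) (hII t (t + 1)),
      hper.intervalIntegral_add_eq t 0, zero_add, hzero, add_zero]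
  have hderiv : deriv Φ = fun t => g (Int.fract t) - c₀ := funext fun t => (hΦd t).deriv
  have hΦs : ContDiff ℝ ∞ Φ := by
    rw [contDiff_infty_iff_deriv, hderiv]
    exact ⟨fun t => (hΦd t).differentiableAt, hP⟩
  have hlift : periodicLift (hΦp.lift : UnitAddCircle → ℝ) = Φ := rfl
  have h1 := H hΦp.lift (by rw [hlift]; exact hΦs)
  rw [hlift, hderiv] at h1
  have h2 : ∫ t in (0 : ℝ)..1, (g (Int.fract t) - c₀) * h t =
      ∫ t in (0 : ℝ)..1, (g t * h t - c₀ * h t) := by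
    refine intervalIntegral.integral_congr_ae ?_
    filter_upwards [hae] with t ht1 ht
    rw [uIoc_of_le zero_le_one] at ht
    rw [hfr t ⟨ht.1, lt_of_le_of_ne ht.2 ht1⟩]
    ring
  have hgh : IntervalIntegrable (fun t => g t * h t) volume 0 1 :=
    hint.continuousOn_mul hg.continuous.continuousOn
  rw [h2, intervalIntegral.integral_sub hgh (hint.const_mul _),
    intervalIntegral.integral_const_mul, ← hc] at h1
  have h3 : ∫ t, g t • (h t - c) = ∫ t in (0 : ℝ)..1, g t • (h t - c) := by
    rw [intervalIntegral.integral_of_le zero_le_one]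
    refine (setIntegral_eq_integral_of_forall_compl_eq_zero fun t ht => ?_).symm
    rw [image_eq_zero_of_notMem_tsupport fun h' => ht (Ioo_subset_Ioc_self (hs h')), zero_smul]
  rw [h3]
  simp only [smul_eq_mul, mul_sub]
  rw [intervalIntegral.integral_sub hgh ((hg.continuous.intervalIntegrable _ _).mul_const _),
    intervalIntegral.integral_mul_const]
  linarith

/-- A scalar function with a weak derivative `v` on the circle agrees almost everywhere with a
primitive of `v`. -/
theorem ae_eq_const_add_integral_of_weakDeriv {u v : ℝ → ℝ} (hu : IntervalIntegrable u volume 0 1)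
    (hv : IntervalIntegrable v volume 0 1)
    (H : ∀ φ : UnitAddCircle → ℝ, ContDiff ℝ ∞ (periodicLift φ) →
      ∫ t in (0 : ℝ)..1, deriv (periodicLift φ) t * u t =
        -∫ t in (0 : ℝ)..1, periodicLift φ t * v t) :
    ∫ t in (0 : ℝ)..1, v t = 0 ∧
      ∃ c, ∀ᵐ t, t ∈ Ioo (0 : ℝ) 1 → u t = c + ∫ s in (0 : ℝ)..t, v s := by
  -- test with `φ = 1`
  have hv0 : ∫ t in (0 : ℝ)..1, v t = 0 := by
    have h1 : periodicLift (fun _ : UnitAddCircle => (1 : ℝ)) = fun _ => 1 := rfl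
    have := H (fun _ => 1) (by rw [h1]; exact contDiff_const)
    rw [h1] at this
    simpa using this
  refine ⟨hv0, ?_⟩
  set Z : ℝ → ℝ := fun t => ∫ s in (0 : ℝ)..t, v s with hZ
  have hZac : AbsolutelyContinuousOnInterval Z 0 1 :=
    hv.absolutelyContinuousOnInterval_intervalIntegral (by simp)
  have hZi : IntervalIntegrable Z volume 0 1 := hZac.continuousOn.intervalIntegrable
  refine ⟨∫ s in (0 : ℝ)..1, (u s - Z s), ?_⟩
  -- by parts, `u - Z` is orthogonal to all derivatives of test functions
  have key := ae_eq_integral_of_integral_deriv_mul_eq_zero (hu.sub hZi) fun φ hφ => ?_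
  · filter_upwards [key] with t ht hmem
    linarith [ht hmem]
  have hφac : AbsolutelyContinuousOnInterval (periodicLift φ) 0 1 :=
    ContDiffOn.absolutelyContinuousOnInterval (hφ.of_le (by exact_mod_cast le_top)).contDiffOn
  have hparts := hφac.integral_mul_deriv_eq_deriv_mul hZac
  have hZ0 : Z 0 = 0 := by simp [hZ]
  have hZ1 : Z 1 = 0 := hv0
  rw [hZ0, hZ1] at hparts
  have hd : ∫ t in (0 : ℝ)..1, periodicLift φ t * deriv Z t =
      ∫ t in (0 : ℝ)..1, periodicLift φ t * v t := by
    refine intervalIntegral.integral_congr_ae ?_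
    filter_upwards [hv.ae_hasDerivAt_integral] with t ht hmem
    rw [(ht (uIoc_subset_uIcc hmem) 0 (by simp)).deriv]
  have hdc : Continuous (deriv (periodicLift φ)) :=
    hφ.continuous_deriv (by exact_mod_cast le_top)
  simp only [mul_sub]
  rw [intervalIntegral.integral_sub (hu.continuousOn_mul hdc.continuousOn)
    (hZi.continuousOn_mul hdc.continuousOn), H φ hφ]
  linarith

variable {n : ℕ}

theorem intervalIntegral_apply {f : ℝ → EuclideanSpace ℝ (Fin n)} {a b : ℝ}
    (hf : IntervalIntegrable f volume a b) (i : Fin n) :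
    (∫ t in a..b, f t) i = ∫ t in a..b, f t i :=
  ((EuclideanSpace.proj (𝕜 := ℝ) i).intervalIntegral_comp_comm hf).symm

theorem HasWeakDerivCircle.ae_eq {u v : UnitAddCircle → EuclideanSpace ℝ (Fin n)}
    (hu : IntervalIntegrable (periodicLift u) volume 0 1)
    (hv : IntervalIntegrable (periodicLift v) volume 0 1) (H : HasWeakDerivCircle u v) :
    ∫ t in (0 : ℝ)..1, periodicLift v t = 0 ∧
      ∃ c, ∀ᵐ t, t ∈ Ioo (0 : ℝ) 1 →
        periodicLift u t = c + ∫ s in (0 : ℝ)..t, periodicLift v s := by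
  have hcoord : ∀ {f : ℝ → EuclideanSpace ℝ (Fin n)}, IntervalIntegrable f volume 0 1 →
      ∀ i, IntervalIntegrable (fun t => f t i) volume 0 1 := fun hf i =>
    ⟨(EuclideanSpace.proj (𝕜 := ℝ) i).integrable_comp hf.1,
      (EuclideanSpace.proj (𝕜 := ℝ) i).integrable_comp hf.2⟩
  have key : ∀ i, _ := fun i =>
    ae_eq_const_add_integral_of_weakDeriv (hcoord hu i) (hcoord hv i) fun φ hφ => by
      have h := congrArg (fun x : EuclideanSpace ℝ (Fin n) => x i) (H φ hφ)
      have hφ' : Continuous (deriv (periodicLift φ)) :=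
        hφ.continuous_deriv (by exact_mod_cast le_top)
      simp only [PiLp.neg_apply] at h
      rw [intervalIntegral_apply (hu.continuousOn_smul hφ'.continuousOn),
        intervalIntegral_apply (hv.continuousOn_smul hφ.continuous.continuousOn)] at h
      simpa using h
  refine ⟨?_, ?_⟩
  · ext i
    rw [intervalIntegral_apply hv]
    exact (key i).1
  · choose c hc using fun i => (key i).2
    refine ⟨WithLp.toLp 2 c, ?_⟩
    filter_upwards [ae_all_iff.2 hc] with t ht hmem
    ext i
    have hvt : IntervalIntegrable (periodicLift v) volume 0 t :=
      hv.mono_set (by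
        rw [uIcc_of_le hmem.1.le, uIcc_of_le zero_le_one]; exact Icc_subset_Icc_right hmem.2.le)
    rw [PiLp.add_apply, intervalIntegral_apply hvt]
    exact ht i hmem

theorem periodicLift_periodic {F : Type*} (u : UnitAddCircle → F) :
    Function.Periodic (periodicLift u) 1 := fun t => by
  simp [periodicLift]

theorem memLp_periodicLift {v : UnitAddCircle → EuclideanSpace ℝ (Fin n)}
    (hv : MemLp v 2 volume) : MemLp (periodicLift v) 2 (volume.restrict (Ioc 0 1)) := by
  have := UnitAddCircle.measurePreserving_mk 0
  rw [zero_add] at this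
  exact hv.comp_measurePreserving this

theorem intervalIntegrable_periodicLift {v : UnitAddCircle → EuclideanSpace ℝ (Fin n)}
    (hv : MemLp v 2 volume) (a b : ℝ) : IntervalIntegrable (periodicLift v) volume a b := by
  refine (periodicLift_periodic v).intervalIntegrable₀ one_ne_zero ?_ a b
  rw [intervalIntegrable_iff_integrableOn_Ioc_of_le zero_le_one]
  exact (memLp_periodicLift hv).integrable (by norm_num)

theorem intervalIntegrable_norm_sq_periodicLift {v : UnitAddCircle → EuclideanSpace ℝ (Fin n)}
    (hv : MemLp v 2 volume) (a b : ℝ) :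
    IntervalIntegrable (fun t => ‖periodicLift v t‖ ^ 2) volume a b := by
  have hp : Function.Periodic (fun t => ‖periodicLift v t‖ ^ 2) 1 := fun t => by
    simp only [periodicLift_periodic v t]
  refine hp.intervalIntegrable₀ one_ne_zero ?_ a b
  rw [intervalIntegrable_iff_integrableOn_Ioc_of_le zero_le_one]
  exact (memLp_periodicLift hv).integrable_norm_pow (by norm_num)

theorem periodic_const_add_integral {f : ℝ → EuclideanSpace ℝ (Fin n)}
    (hf : ∀ a b, IntervalIntegrable f volume a b) (hp : Function.Periodic f 1)
    (h0 : ∫ t in (0 : ℝ)..1, f t = 0) (c : EuclideanSpace ℝ (Fin n)) :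
    Function.Periodic (fun t => c + ∫ s in (0 : ℝ)..t, f s) 1 := fun t => by
  simp only
  rw [← intervalIntegral.integral_add_adjacent_intervals (hf 0 t) (hf t (t + 1)),
    hp.intervalIntegral_add_eq t 0, zero_add, h0, add_zero]

/-- An `H²` closed curve is of class `C¹`, and its velocity is a primitive of an `L²` function. -/
theorem IsH2ClosedCurve.exists_velocity {γ : UnitAddCircle → EuclideanSpace ℝ (Fin n)}
    (hγ : IsH2ClosedCurve γ) :
    ∃ w : ℝ → EuclideanSpace ℝ (Fin n), (∀ a b, IntervalIntegrable w volume a b) ∧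
      (∀ a b, IntervalIntegrable (fun t => ‖w t‖ ^ 2) volume a b) ∧
      (∀ t, HasDerivAt (periodicLift γ) (velocity γ t) t) ∧
      ∀ s t, velocity γ t - velocity γ s = ∫ r in s..t, w r := by
  obtain ⟨hcont, v, w, hv, hw, hγv, hvw⟩ := hγ
  have hγc : Continuous (periodicLift γ) := hcont.comp (AddCircle.continuous_mk' 1)
  have hvi := intervalIntegrable_periodicLift hv
  have hwi := intervalIntegrable_periodicLift hw
  obtain ⟨hw0, c, hc⟩ := hvw.ae_eq (hvi 0 1) (hwi 0 1)
  obtain ⟨hv0, c₁, hc₁⟩ := hγv.ae_eq (hγc.intervalIntegrable 0 1) (hvi 0 1)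
  set V : ℝ → EuclideanSpace ℝ (Fin n) := fun t => c + ∫ s in (0 : ℝ)..t, periodicLift w s with hV
  have hVc : Continuous V := continuous_const.add (intervalIntegral.continuous_primitive hwi 0)
  have hVp : Function.Periodic V 1 :=
    periodic_const_add_integral hwi (periodicLift_periodic w) hw0 c
  have hae : ∀ᵐ t : ℝ, t ≠ 1 := by simp [ae_iff, measure_singleton]
  have hVv : ∀ t ∈ Icc (0 : ℝ) 1, ∫ s in (0 : ℝ)..t, V s =
      ∫ s in (0 : ℝ)..t, periodicLift v s := fun t ht => by
    refine intervalIntegral.integral_congr_ae ?_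
    filter_upwards [hc, hae] with s hs hs1 hmem
    rw [uIoc_of_le ht.1] at hmem
    exact (hs ⟨hmem.1, lt_of_le_of_ne (hmem.2.trans ht.2) hs1⟩).symm
  have hVi : ∀ a b, IntervalIntegrable V volume a b := fun a b => hVc.intervalIntegrable a b
  have hGp := periodic_const_add_integral hVi hVp
    ((hVv 1 (by simp)).trans hv0) c₁
  have hGc : Continuous fun t => c₁ + ∫ s in (0 : ℝ)..t, V s :=
    continuous_const.add (intervalIntegral.continuous_primitive hVi 0)
  have heq01 : EqOn (periodicLift γ) (fun t => c₁ + ∫ s in (0 : ℝ)..t, V s) (Icc 0 1) := by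
    refine Measure.eqOn_Icc_of_ae_eq volume zero_ne_one ?_ hγc.continuousOn hGc.continuousOn
    rw [Filter.EventuallyEq, ae_restrict_iff' measurableSet_Icc]
    have hae0 : ∀ᵐ t : ℝ, t ≠ 0 := by simp [ae_iff, measure_singleton]
    filter_upwards [hc₁, hae, hae0] with t ht h1 h0 hmem
    rw [hVv t hmem]
    exact ht ⟨lt_of_le_of_ne hmem.1 h0.symm, lt_of_le_of_ne hmem.2 h1⟩
  have heq : periodicLift γ = fun t => c₁ + ∫ s in (0 : ℝ)..t, V s := by
    funext t
    obtain ⟨s, hs, hγs⟩ : ∃ s ∈ Ico (0 : ℝ) 1, s = Int.fract t :=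
      ⟨_, ⟨Int.fract_nonneg t, Int.fract_lt_one t⟩, rfl⟩
    have ht : t = s + (⌊t⌋ : ℤ) * 1 := by rw [hγs, mul_one, Int.fract_add_floor]
    have h1 := (periodicLift_periodic γ).int_mul ⌊t⌋ s
    have h2 := hGp.int_mul ⌊t⌋ s
    rw [ht]
    exact h1.trans ((heq01 ⟨hs.1, hs.2.le⟩).trans h2.symm)
  have hder : ∀ t, HasDerivAt (periodicLift γ) (V t) t := fun t => by
    rw [heq]
    exact (intervalIntegral.integral_hasDerivAt_right (hVi _ _)
      (hVc.stronglyMeasurableAtFilter _ _) hVc.continuousAt).const_add c₁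
  have hvel : velocity γ = V := funext fun t => (hder t).deriv
  refine ⟨periodicLift w, hwi, intervalIntegrable_norm_sq_periodicLift hw, ?_, ?_⟩
  · rw [hvel]; exact hder
  · intro s t
    rw [hvel]
    simp only [hV, add_sub_add_left_eq_sub]
    exact intervalIntegral.integral_interval_sub_left (hwi _ _) (hwi _ _)

end WeakDerivatives

/-! ### The bending energy of a loop -/

section Loops

/-- A function whose increments are dominated by those of an absolutely continuous function is
absolutely continuous. -/
theorem AbsolutelyContinuousOnInterval.of_dist_le {X Y : Type*} [PseudoMetricSpace X]
    [PseudoMetricSpace Y] {f : ℝ → X} {g : ℝ → Y} {a b : ℝ} (C : ℝ)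
    (hg : AbsolutelyContinuousOnInterval g a b)
    (h : ∀ s ∈ uIcc a b, ∀ t ∈ uIcc a b, dist (f s) (f t) ≤ C * dist (g s) (g t)) :
    AbsolutelyContinuousOnInterval f a b := by
  have hC := Filter.Tendsto.const_mul C hg
  rw [mul_zero] at hC
  refine squeeze_zero' (Filter.Eventually.of_forall fun _ => Finset.sum_nonneg fun _ _ =>
    dist_nonneg) ?_ hC
  refine Filter.mem_inf_of_right (Filter.mem_principal.2 fun I hI => ?_)
  simp only [Set.mem_ofPred_eq, Finset.mul_sum]
  exact Finset.sum_le_sum fun i hi => h _ (hI.1 i hi).1 _ (hI.1 i hi).2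

/-- Integrating `F` along an absolutely continuous function whose speed is at most `ρ`. -/
theorem abs_integral_le_integral_comp_mul {θ ρ F : ℝ → ℝ} {a b C : ℝ} (hab : a ≤ b)
    (hF : Continuous F) (hF0 : ∀ x, 0 ≤ F x) (hFC : ∀ x, F x ≤ C)
    (hθ : AbsolutelyContinuousOnInterval θ a b) (hρ : IntervalIntegrable ρ volume a b)
    (h : ∀ᵐ t, t ∈ Icc a b → |deriv θ t| ≤ ρ t) :
    |∫ x in θ a..θ b, F x| ≤ ∫ t in a..b, F (θ t) * ρ t := by
  have hFi : ∀ x y, IntervalIntegrable F volume x y := fun x y => hF.intervalIntegrable x y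
  set Ψ : ℝ → ℝ := fun x => ∫ y in (0 : ℝ)..x, F y with hΨ
  have hsub : ∀ x y, Ψ y - Ψ x = ∫ z in x..y, F z := fun x y =>
    intervalIntegral.integral_interval_sub_left (hFi _ _) (hFi _ _)
  have hac : AbsolutelyContinuousOnInterval (Ψ ∘ θ) a b := by
    refine .of_dist_le C hθ fun s _ t _ => ?_
    rw [dist_comm, dist_comm (θ s), Real.dist_eq, Real.dist_eq]
    simp only [Function.comp]
    rw [hsub]
    rw [← Real.norm_eq_abs, ← Real.norm_eq_abs]
    refine intervalIntegral.norm_integral_le_of_norm_le_const fun x _ => ?_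
    rw [Real.norm_of_nonneg (hF0 x)]
    exact hFC x
  have hint := hac.integral_deriv_eq_sub
  simp only [Function.comp] at hint
  rw [hsub] at hint
  rw [← hint, ← Real.norm_eq_abs]
  refine intervalIntegral.norm_integral_le_of_norm_le (g := fun t => F (θ t) * ρ t) hab ?_
    (hρ.continuousOn_mul (hF.comp_continuousOn hθ.continuousOn))
  filter_upwards [hθ.ae_differentiableAt, h] with t ht hρt hmem
  have hmem' : t ∈ Icc a b := Ioc_subset_Icc_self hmem
  have hd : HasDerivAt Ψ (F (θ t)) (θ t) :=
    intervalIntegral.integral_hasDerivAt_right (hFi _ _)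
      (hF.stronglyMeasurableAtFilter _ _) hF.continuousAt
  have hd2 := hd.comp t (ht (by rwa [uIcc_of_le hab])).hasDerivAt
  rw [hd2.deriv, norm_mul, Real.norm_of_nonneg (hF0 _)]
  exact mul_le_mul_of_nonneg_left (hρt hmem') (hF0 _)

variable {E : Type*} [NormedAddCommGroup E] [InnerProductSpace ℝ E]

/-- The angle between two vectors is at most a multiple of the chord. -/
theorem angle_sq_mul_le (x y : E) :
    4 * (‖x‖ * ‖y‖) * InnerProductGeometry.angle x y ^ 2 ≤ Real.pi ^ 2 * ‖x - y‖ ^ 2 := by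
  have h1 := Real.cos_le_one_sub_mul_cos_sq (x := InnerProductGeometry.angle x y) (by
    rw [abs_of_nonneg (InnerProductGeometry.angle_nonneg x y)]
    exact InnerProductGeometry.angle_le_pi x y)
  have h2 := InnerProductGeometry.cos_angle_mul_norm_mul_norm x y
  have h3 := norm_sub_sq_real x y
  have h4 := mul_le_mul_of_nonneg_right h1 (by positivity : 0 ≤ ‖x‖ * ‖y‖)
  rw [h2] at h4
  have h5 : 4 * (‖x‖ * ‖y‖) * InnerProductGeometry.angle x y ^ 2 =
      Real.pi ^ 2 * (2 * (2 / Real.pi ^ 2 * InnerProductGeometry.angle x y ^ 2 * (‖x‖ * ‖y‖))) := by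
    field_simp
    ring
  rw [h5]
  gcongr
  nlinarith [sq_nonneg (‖x‖ - ‖y‖)]

/-- A curve of unit vectors moves away from a fixed direction at most with its own speed. -/
theorem abs_deriv_angle_le {T : ℝ → E} {e T' : E} {θ' t : ℝ} (he : ‖e‖ = 1)
    (hT : ∀ s, ‖T s‖ = 1) (hd : HasDerivAt T T' t)
    (hθ : HasDerivAt (fun s => InnerProductGeometry.angle e (T s)) θ' t) : |θ'| ≤ ‖T'‖ := by
  set θ : ℝ → ℝ := fun s => InnerProductGeometry.angle e (T s) with hθdef
  have hcos : ∀ s, Real.cos (θ s) = inner ℝ e (T s) := fun s => by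
    simp [hθdef, InnerProductGeometry.cos_angle, he, hT]
  have h0 : 0 ≤ Real.sin (θ t) := InnerProductGeometry.sin_angle_nonneg _ _
  rcases h0.eq_or_lt with h | h
  · -- at `θ = 0` or `θ = π` the angle has an extremum
    have hθ0 : θ' = 0 := by
      rcases InnerProductGeometry.sin_eq_zero_iff_angle_eq_zero_or_angle_eq_pi.1 h.symm with hz | hz
      · refine IsLocalMin.hasDerivAt_eq_zero (Filter.Eventually.of_forall fun s => ?_) hθ
        exact hz.le.trans (InnerProductGeometry.angle_nonneg _ _)
      · refine IsLocalMax.hasDerivAt_eq_zero (Filter.Eventually.of_forall fun s => ?_) hθ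
        exact (InnerProductGeometry.angle_le_pi _ _).trans hz.ge
    rw [hθ0, abs_zero]
    exact norm_nonneg _
  · have h1 : HasDerivAt (fun s => Real.cos (θ s)) (inner ℝ e T') t := by
      simp only [hcos]
      simpa using (hasDerivAt_const t e).inner ℝ hd
    have h2 : -Real.sin (θ t) * θ' = inner ℝ e T' := hθ.cos.unique h1
    have h3 : inner ℝ (T t) T' = 0 := by
      have h4 := hd.norm_sq
      simp only [hT] at h4
      have := h4.unique (hasDerivAt_const t _)
      linarith
    have h5 : inner ℝ (e - Real.cos (θ t) • T t) T' = -Real.sin (θ t) * θ' := by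
      rw [inner_sub_left, real_inner_smul_left, h3, h2]; ring
    have h6 : ‖e - Real.cos (θ t) • T t‖ = Real.sin (θ t) := by
      rw [← sq_eq_sq₀ (norm_nonneg _) h0, norm_sub_sq_real, real_inner_smul_right, ← hcos,
        norm_smul, hT, he, Real.norm_eq_abs, mul_one, sq_abs]
      linear_combination -Real.sin_sq_add_cos_sq (θ t)
    have h7 := abs_real_inner_le_norm (e - Real.cos (θ t) • T t) T'
    rw [h5, h6, abs_mul, abs_neg, abs_of_pos h] at h7
    exact le_of_mul_le_mul_left h7 h

/-- The unit vector in the direction of `V`. -/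
noncomputable def direction (V : ℝ → E) (t : ℝ) : E := ‖V t‖⁻¹ • V t

/-- The density `|κ|² |γ'|` of the bending energy of a curve with velocity `V`. -/
noncomputable def bendingDensity (V : ℝ → E) (t : ℝ) : ℝ :=
  ‖‖V t‖⁻¹ • deriv (direction V) t‖ ^ 2 * ‖V t‖

/-- The velocity `V` of an immersed curve of class `H²`, with weak acceleration `w`: a nowhere
vanishing primitive of the locally square integrable function `w`. -/
structure IsImmersedVelocity (V w : ℝ → E) : Prop where
  ne_zero : ∀ t, V t ≠ 0
  integrable : ∀ a b, IntervalIntegrable w volume a b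
  integrable_sq : ∀ a b, IntervalIntegrable (fun t => ‖w t‖ ^ 2) volume a b
  sub_eq : ∀ s t, V t - V s = ∫ r in s..t, w r

namespace IsImmersedVelocity

variable {V w : ℝ → E}

theorem norm_pos (hV : IsImmersedVelocity V w) (t : ℝ) : 0 < ‖V t‖ :=
  norm_pos_iff.2 (hV.ne_zero t)

theorem norm_direction (hV : IsImmersedVelocity V w) (t : ℝ) : ‖direction V t‖ = 1 := by
  rw [direction, norm_smul, norm_inv, norm_norm, inv_mul_cancel₀ (hV.norm_pos t).ne']

theorem eq_add (hV : IsImmersedVelocity V w) : V = fun t => V 0 + ∫ r in (0 : ℝ)..t, w r :=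
  funext fun t => by rw [← hV.sub_eq]; abel

theorem continuous (hV : IsImmersedVelocity V w) : Continuous V := by
  rw [hV.eq_add]
  exact continuous_const.add (intervalIntegral.continuous_primitive hV.integrable 0)

theorem integral_norm_pos (hV : IsImmersedVelocity V w) {a b : ℝ} (hab : a < b) :
    0 < ∫ t in a..b, ‖V t‖ :=
  intervalIntegral.intervalIntegral_pos_of_pos (hV.continuous.norm.intervalIntegrable _ _)
    (fun t => hV.norm_pos t) hab

theorem ae_hasDerivAt [CompleteSpace E] (hV : IsImmersedVelocity V w) :
    ∀ᵐ t, HasDerivAt V (w t) t := by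
  have hloc : LocallyIntegrable w volume := fun x => by
    refine ⟨Icc (x - 1) (x + 1), Icc_mem_nhds (by linarith) (by linarith), ?_⟩
    rw [← intervalIntegrable_iff_integrableOn_Icc_of_le (by linarith)]
    exact hV.integrable _ _
  filter_upwards [LocallyIntegrable.ae_hasDerivAt_integral hloc] with t ht
  have := (ht 0).const_add (V 0)
  rwa [← hV.eq_add] at this

theorem ae_hasDerivAt_direction [CompleteSpace E] (hV : IsImmersedVelocity V w) :
    ∀ᵐ t, HasDerivAt (direction V) (deriv (direction V) t) t ∧
      ‖deriv (direction V) t‖ ≤ 2 * (‖V t‖⁻¹ * ‖w t‖) := by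
  filter_upwards [hV.ae_hasDerivAt] with t ht
  have hp := hV.norm_pos t
  have h1 := ht.norm_sq.sqrt (by positivity)
  simp only [Real.sqrt_sq (norm_nonneg _)] at h1
  have h2 : HasDerivAt (direction V) _ t := (h1.inv hp.ne').smul ht
  rw [h2.deriv]
  refine ⟨h2, (norm_add_le _ _).trans ?_⟩
  have h3 := abs_real_inner_le_norm (V t) (w t)
  have h4 : ‖(-(2 * inner ℝ (V t) (w t) / (2 * ‖V t‖)) / ‖V t‖ ^ 2) • V t‖ ≤
      ‖V t‖⁻¹ * ‖w t‖ := by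
    rw [norm_smul, Real.norm_eq_abs, abs_div, abs_neg, abs_div, abs_mul,
      abs_of_pos (by positivity : (0 : ℝ) < 2), abs_of_pos (by positivity : 0 < 2 * ‖V t‖),
      abs_of_pos (by positivity : 0 < ‖V t‖ ^ 2)]
    calc _ = |inner ℝ (V t) (w t)| / ‖V t‖ ^ 2 := by field_simp
      _ ≤ ‖V t‖ * ‖w t‖ / ‖V t‖ ^ 2 := by gcongr
      _ = _ := by field_simp
  have h5 : ‖(‖V t‖⁻¹) • w t‖ = ‖V t‖⁻¹ * ‖w t‖ := by
    rw [norm_smul, norm_inv, norm_norm]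
  simp only [Pi.inv_apply] at *
  rw [h5]
  linarith

theorem intervalIntegrable_norm_deriv_direction [CompleteSpace E]
    (hV : IsImmersedVelocity V w) (a b : ℝ) :
    IntervalIntegrable (fun t => ‖deriv (direction V) t‖) volume a b := by
  have hg : IntervalIntegrable (fun t => 2 * (‖V t‖⁻¹ * ‖w t‖)) volume a b :=
    ((hV.integrable a b).norm.continuousOn_mul
      (hV.continuous.norm.inv₀ fun t => (hV.norm_pos t).ne').continuousOn).const_mul 2
  refine hg.mono_fun (stronglyMeasurable_deriv _).norm.aestronglyMeasurable ?_
  refine ae_restrict_of_ae ?_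
  filter_upwards [hV.ae_hasDerivAt_direction] with t ht
  rw [norm_norm]
  exact ht.2.trans (le_abs_self _)

theorem bendingDensity_nonneg (V : ℝ → E) (t : ℝ) : 0 ≤ bendingDensity V t := by
  unfold bendingDensity; positivity

theorem intervalIntegrable_bendingDensity [CompleteSpace E]
    (hV : IsImmersedVelocity V w) (a b : ℝ) :
    IntervalIntegrable (bendingDensity V) volume a b := by
  have hinv : Continuous fun t => ‖V t‖⁻¹ :=
    hV.continuous.norm.inv₀ fun t => (hV.norm_pos t).ne'
  have hg : IntervalIntegrable (fun t => 4 * ((‖V t‖⁻¹) ^ 4 * ‖V t‖ * ‖w t‖ ^ 2)) volume a b :=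
    ((hV.integrable_sq a b).continuousOn_mul
      ((hinv.pow 4).mul hV.continuous.norm).continuousOn).const_mul 4
  refine hg.mono_fun (StronglyMeasurable.aestronglyMeasurable ?_) ?_
  · exact ((hinv.stronglyMeasurable.smul (stronglyMeasurable_deriv _)).norm.pow 2).mul
      hV.continuous.norm.stronglyMeasurable
  refine ae_restrict_of_ae ?_
  filter_upwards [hV.ae_hasDerivAt_direction] with t ht
  rw [Real.norm_of_nonneg (bendingDensity_nonneg V t), Real.norm_of_nonneg (by positivity)]
  rw [bendingDensity, norm_smul, norm_inv, norm_norm]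
  calc (‖V t‖⁻¹ * ‖deriv (direction V) t‖) ^ 2 * ‖V t‖
      ≤ (‖V t‖⁻¹ * (2 * (‖V t‖⁻¹ * ‖w t‖))) ^ 2 * ‖V t‖ := by gcongr; exact ht.2
    _ = _ := by ring

theorem absolutelyContinuous_angle [CompleteSpace E] (hV : IsImmersedVelocity V w) (e : E)
    (a b : ℝ) :
    AbsolutelyContinuousOnInterval
      (fun t => InnerProductGeometry.angle e (direction V t)) a b := by
  obtain ⟨x, _, hx⟩ := isCompact_uIcc.exists_isMinOn (nonempty_uIcc (a := a) (b := b))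
    hV.continuous.norm.continuousOn
  set δ := ‖V x‖
  have hδ : 0 < δ := hV.norm_pos x
  have hg : AbsolutelyContinuousOnInterval (fun t => ∫ r in a..t, ‖w r‖) a b :=
    (hV.integrable a b).norm.absolutelyContinuousOnInterval_intervalIntegral (by simp)
  refine .of_dist_le (Real.pi / (2 * δ)) hg fun s hs t ht => ?_
  have hang : ∀ r, InnerProductGeometry.angle e (direction V r) =
      InnerProductGeometry.angle e (V r) := fun r =>
    InnerProductGeometry.angle_smul_right_of_pos _ _ (inv_pos.2 (hV.norm_pos r))
  rw [hang, hang]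
  have h1 : dist (InnerProductGeometry.angle e (V s)) (InnerProductGeometry.angle e (V t)) ≤
      InnerProductGeometry.angle (V s) (V t) := by
    rw [Real.dist_eq, abs_sub_le_iff]
    have ha := InnerProductGeometry.angle_le_angle_add_angle e (V t) (V s)
    have hb := InnerProductGeometry.angle_le_angle_add_angle e (V s) (V t)
    rw [InnerProductGeometry.angle_comm (V t) (V s)] at ha
    constructor <;> linarith
  have h2 : InnerProductGeometry.angle (V s) (V t) ≤ Real.pi / (2 * δ) * ‖V s - V t‖ := by
    have h3 := angle_sq_mul_le (V s) (V t)
    have h4 : δ * δ ≤ ‖V s‖ * ‖V t‖ := mul_le_mul (hx hs) (hx ht) hδ.le (norm_nonneg _)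
    refine (sq_le_sq₀ (InnerProductGeometry.angle_nonneg _ _) (by positivity)).1 ?_
    rw [mul_pow, div_pow, div_mul_eq_mul_div, le_div_iff₀ (by positivity)]
    nlinarith [mul_le_mul_of_nonneg_right h4
      (sq_nonneg (InnerProductGeometry.angle (V s) (V t)))]
  refine h1.trans (h2.trans ?_)
  gcongr
  have hi := fun c d => (hV.integrable c d).norm
  rw [norm_sub_rev, hV.sub_eq, dist_comm, Real.dist_eq,
    intervalIntegral.integral_interval_sub_left (hi _ _) (hi _ _)]
  exact intervalIntegral.norm_integral_le_abs_integral_norm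

theorem ae_abs_deriv_angle_le [CompleteSpace E] (hV : IsImmersedVelocity V w) {e : E}
    (he : ‖e‖ = 1) (a b : ℝ) :
    ∀ᵐ t, t ∈ uIcc a b → |deriv (fun s => InnerProductGeometry.angle e (direction V s)) t| ≤
      ‖deriv (direction V) t‖ := by
  filter_upwards [(hV.absolutelyContinuous_angle e a b).ae_differentiableAt,
    hV.ae_hasDerivAt_direction] with t ht htT hmem
  exact abs_deriv_angle_le he hV.norm_direction htT.1 (ht hmem).hasDerivAt

/-- Lower bound for the bending energy of an arc of length `L / 2` in terms of its displacement in
the direction `e` of one of its tangents. Equality holds for the half of the optimal loop. -/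
theorem le_integral_bendingDensity_add [CompleteSpace E] (hV : IsImmersedVelocity V w)
    {a b x₀ L m₀ : ℝ} (hx₀ : x₀ ∈ Icc a b) (hm₀ : m₀ < 1) (hL : 0 < L)
    (hlen : ∫ t in a..b, ‖V t‖ = L / 2) :
    (16 * ellipticK m₀ * (ellipticE m₀ - (1 - m₀) * ellipticK m₀) +
      4 * ellipticK m₀ ^ 2 * (1 - 2 * m₀)) / L ≤
      (∫ t in a..b, bendingDensity V t) + 8 * ellipticK m₀ ^ 2 / L ^ 2 *
        ∫ t in a..b, inner ℝ (direction V x₀) (V t) := by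
  have hab : a ≤ b := hx₀.1.trans hx₀.2
  have hK := ellipticK_pos hm₀
  set K := ellipticK m₀
  set e := direction V x₀ with he
  have he1 : ‖e‖ = 1 := hV.norm_direction x₀
  set θ : ℝ → ℝ := fun t => InnerProductGeometry.angle e (direction V t) with hθ
  have hθac : ∀ c d, AbsolutelyContinuousOnInterval θ c d := hV.absolutelyContinuous_angle e
  have hcosθ : ∀ t, Real.cos (θ t) = inner ℝ e (direction V t) := fun t => by
    simp [hθ, InnerProductGeometry.cos_angle, he1, hV.norm_direction]
  have hθ0 : θ x₀ = 0 := InnerProductGeometry.angle_self (norm_ne_zero_iff.1 (by simp [he1]))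
  have hθc : ContinuousOn θ (Icc a b) := by
    have := (hθac a b).continuousOn
    rwa [uIcc_of_le hab] at this
  obtain ⟨x₁, hx₁, hmax⟩ := isCompact_Icc.exists_isMaxOn ⟨x₀, hx₀⟩ hθc
  set M := θ x₁
  have hM : M ∈ Icc 0 Real.pi :=
    ⟨InnerProductGeometry.angle_nonneg _ _, InnerProductGeometry.angle_le_pi _ _⟩
  have hq : ∀ t ∈ Icc a b, 0 ≤ Real.cos (θ t) - Real.cos M := fun t ht =>
    sub_nonneg.2 (Real.cos_le_cos_of_nonneg_of_le_pi (InnerProductGeometry.angle_nonneg _ _) hM.2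
      (hmax ht))
  set F : ℝ → ℝ := fun x => Real.sqrt (Real.cos x - Real.cos M) with hF
  have hFc : Continuous F := by fun_prop
  have hF0 : ∀ x, 0 ≤ F x := fun x => Real.sqrt_nonneg _
  have hF2 : ∀ x, F x ≤ 2 := fun x => Real.sqrt_le_iff.2
    ⟨zero_le_two, by linarith [Real.cos_le_one x, Real.neg_one_le_cos M]⟩
  set ρ : ℝ → ℝ := fun t => ‖deriv (direction V) t‖ with hρ
  have hρi : ∀ c d, IntervalIntegrable ρ volume c d := hV.intervalIntegrable_norm_deriv_direction
  have hFρi : IntervalIntegrable (fun t => F (θ t) * ρ t) volume a b :=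
    (hρi a b).continuousOn_mul (hFc.comp_continuousOn (hθac a b).continuousOn)
  -- the pendulum action bounds `∫ F(θ) ρ` from below
  have hG : ∫ x in (0 : ℝ)..M, F x ≤ ∫ t in a..b, F (θ t) * ρ t := by
    have hnonneg : ∀ t, 0 ≤ F (θ t) * ρ t := fun t => mul_nonneg (hF0 _) (norm_nonneg _)
    have hsub : ∀ c d, c ≤ d → a ≤ c → d ≤ b →
        |∫ x in θ c..θ d, F x| ≤ ∫ t in a..b, F (θ t) * ρ t := fun c d hcd hac hdb =>
      (abs_integral_le_integral_comp_mul hcd hFc hF0 hF2 (hθac c d) (hρi c d) (by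
        have := hV.ae_abs_deriv_angle_le he1 c d
        rwa [uIcc_of_le hcd] at this)).trans
      (intervalIntegral.integral_mono_interval hac hcd hdb
        (Filter.Eventually.of_forall hnonneg) hFρi)
    rcases le_total x₀ x₁ with h | h
    · have := hsub x₀ x₁ h hx₀.1 hx₁.2
      rw [hθ0] at this
      exact (le_abs_self _).trans this
    · have := hsub x₁ x₀ h hx₁.1 hx₀.2
      rw [hθ0, intervalIntegral.integral_symm, abs_neg] at this
      exact (le_abs_self _).trans this
  -- this multiplier makes the tangent bound at `m₀` independent of the amplitude `M`
  set r := 2 * Real.sqrt 2 * K / L with hr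
  have h2 : Real.sqrt 2 ^ 2 = 2 := Real.sq_sqrt zero_le_two
  have hr2 : r ^ 2 = 8 * K ^ 2 / L ^ 2 := by
    rw [hr, div_pow, mul_pow, mul_pow, h2]; ring
  have hr0 : 0 ≤ r := by positivity
  have hVi : IntervalIntegrable (fun t => ‖V t‖) volume a b :=
    hV.continuous.norm.intervalIntegrable _ _
  have hinner : IntervalIntegrable (fun t => inner ℝ e (V t)) volume a b :=
    (continuous_const.inner hV.continuous).intervalIntegrable _ _
  -- Young's inequality, pointwise, with equality when `|κ| = r F(θ)`
  have hyoung : ∫ t in a..b, 2 * r * (F (θ t) * ρ t) ≤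
      ∫ t in a..b, (bendingDensity V t +
        (r ^ 2 * inner ℝ e (V t) - r ^ 2 * Real.cos M * ‖V t‖)) := by
    refine intervalIntegral.integral_mono_on hab (hFρi.const_mul _)
      ((hV.intervalIntegrable_bendingDensity a b).add
        ((hinner.const_mul _).sub (hVi.const_mul _))) fun t ht => ?_
    have hp := hV.norm_pos t
    have hsq : F (θ t) ^ 2 = Real.cos (θ t) - Real.cos M := Real.sq_sqrt (hq t ht)
    have hin : inner ℝ e (V t) = Real.cos (θ t) * ‖V t‖ := by
      rw [hcosθ, direction, real_inner_smul_right]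
      field_simp
    have hD : bendingDensity V t = (‖V t‖⁻¹ * ρ t) ^ 2 * ‖V t‖ := by
      rw [bendingDensity, norm_smul, norm_inv, norm_norm]
    have hid : bendingDensity V t + (r ^ 2 * inner ℝ e (V t) - r ^ 2 * Real.cos M * ‖V t‖) -
        2 * r * (F (θ t) * ρ t) = ‖V t‖ * (‖V t‖⁻¹ * ρ t - r * F (θ t)) ^ 2 := by
      have hcos : Real.cos (θ t) = F (θ t) ^ 2 + Real.cos M := by linarith
      rw [hD, hin, hcos]
      field_simp
      ring
    have : 0 ≤ ‖V t‖ * (‖V t‖⁻¹ * ρ t - r * F (θ t)) ^ 2 := by positivity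
    linarith
  rw [intervalIntegral.integral_const_mul,
    intervalIntegral.integral_add (hV.intervalIntegrable_bendingDensity a b)
      ((hinner.const_mul _).sub (hVi.const_mul _)),
    intervalIntegral.integral_sub (hinner.const_mul _) (hVi.const_mul _),
    intervalIntegral.integral_const_mul, intervalIntegral.integral_const_mul, hlen] at hyoung
  have htan := mul_le_mul_of_nonneg_left
    ((tangent_le_integral_sqrt_cos_sub_cos hM hm₀).trans hG) (by positivity : 0 ≤ 2 * r)
  rw [← hr2]
  have hval : 2 * r * (2 * Real.sqrt 2 * (ellipticE m₀ - (1 - m₀) * K +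
      ((1 - Real.cos M) / 2 - m₀) * (K / 2))) + r ^ 2 * Real.cos M * (L / 2) =
      (16 * K * (ellipticE m₀ - (1 - m₀) * K) + 4 * K ^ 2 * (1 - 2 * m₀)) / L := by
    rw [hr2, hr]
    field_simp
    rw [h2]
    ring
  linarith

/-- A closed loop, with no condition on the tangents at its base point, has normalized bending
energy at least `ϖ*`. -/
theorem varpi_div_le_integral_bendingDensity [CompleteSpace E] (hV : IsImmersedVelocity V w)
    {a b m₀ : ℝ} (hab : a < b) (hm₀ : IsMStar m₀) (hclosed : ∫ t in a..b, V t = 0) :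
    varpi m₀ / (∫ t in a..b, ‖V t‖) ≤ ∫ t in a..b, bendingDensity V t := by
  have hL := hV.integral_norm_pos hab
  have hVn : ∀ c d, IntervalIntegrable (fun t => ‖V t‖) volume c d := fun c d =>
    hV.continuous.norm.intervalIntegrable c d
  set L := ∫ t in a..b, ‖V t‖ with hLdef
  -- cut the loop at its midpoint: the two halves are compared with the same tangent there, and
  -- their displacements in that direction cancel
  obtain ⟨c, hc, hlen⟩ : ∃ c ∈ Icc a b, ∫ t in a..c, ‖V t‖ = L / 2 := by
    refine intermediate_value_Icc hab.le
      (intervalIntegral.continuous_primitive hVn a).continuousOn ⟨?_, ?_⟩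
    · rw [intervalIntegral.integral_same]; positivity
    · linarith
  have hlen' : ∫ t in c..b, ‖V t‖ = L / 2 := by
    have := intervalIntegral.integral_add_adjacent_intervals (hVn a c) (hVn c b)
    linarith
  have h1 := hV.le_integral_bendingDensity_add (x₀ := c) ⟨hc.1, le_rfl⟩ hm₀.1.2 hL hlen
  have h2 := hV.le_integral_bendingDensity_add (x₀ := c) ⟨le_rfl, hc.2⟩ hm₀.1.2 hL hlen'
  have hD := intervalIntegral.integral_add_adjacent_intervals
    (hV.intervalIntegrable_bendingDensity a c) (hV.intervalIntegrable_bendingDensity c b)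
  have hVi : ∀ c d, IntervalIntegrable V volume c d := fun c d =>
    hV.continuous.intervalIntegrable c d
  have hI : (∫ t in a..c, inner ℝ (direction V c) (V t)) +
      ∫ t in c..b, inner ℝ (direction V c) (V t) = 0 := by
    have hi : ∀ x y, IntervalIntegrable (fun t => inner ℝ (direction V c) (V t)) volume x y :=
      fun x y => (continuous_const.inner hV.continuous).intervalIntegrable _ _
    rw [intervalIntegral.integral_add_adjacent_intervals (hi _ _) (hi _ _)]
    have := (innerSL ℝ (direction V c)).intervalIntegral_comp_comm (hVi a b)
    rw [hclosed, map_zero] at this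
    simpa using this
  have hval : varpi m₀ / L = 2 * ((16 * ellipticK m₀ * (ellipticE m₀ - (1 - m₀) * ellipticK m₀) +
      4 * ellipticK m₀ ^ 2 * (1 - 2 * m₀)) / L) := by
    rw [varpi, hm₀.2]
    ring
  have hsum := congrArg (fun x => 8 * ellipticK m₀ ^ 2 / L ^ 2 * x) hI
  simp only [mul_add, mul_zero] at hsum
  rw [hval]
  linarith

end IsImmersedVelocity

end Loops

/-! ### Multiple points of closed curves -/

theorem Function.Periodic.deriv_periodic {F : Type*} [NormedAddCommGroup F] [NormedSpace ℝ F]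
    {f : ℝ → F} {c : ℝ} (hf : Function.Periodic f c) : Function.Periodic (deriv f) c := fun t => by
  rw [← deriv_comp_add_const, show (fun x => f (x + c)) = f from funext hf]

variable {n : ℕ}

/-- Distinct preimages of a point cut the circle into consecutive arcs. -/
theorem HasPointOfMultiplicity.exists_partition {γ : UnitAddCircle → EuclideanSpace ℝ (Fin n)}
    {p : EuclideanSpace ℝ (Fin n)} {k : ℕ} (hk : 0 < k) (h : HasPointOfMultiplicity γ p k) :
    ∃ t : ℕ → ℝ, t k = t 0 + 1 ∧ (∀ i < k, t i < t (i + 1)) ∧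
      ∀ i ≤ k, periodicLift γ (t i) = p := by
  obtain ⟨S, hS, hSk⟩ := exists_subset_encard_eq h
  have hfin : S.Finite := finite_of_encard_eq_coe hSk
  have hr : ∀ x : UnitAddCircle, ((AddCircle.equivIco 1 0 x : ℝ) : UnitAddCircle) = x :=
    fun x => (AddCircle.equivIco 1 0).symm_apply_apply x
  have hinj : Function.Injective fun x : UnitAddCircle => (AddCircle.equivIco 1 0 x : ℝ) :=
    fun x y hxy => (AddCircle.equivIco 1 0).injective (Subtype.ext hxy)
  set R := hfin.toFinset.image fun x => (AddCircle.equivIco (1 : ℝ) 0 x : ℝ) with hR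
  have hcard : R.card = k := by
    rw [hR, Finset.card_image_of_injective _ hinj]
    rw [hfin.encard_eq_coe_toFinset_card] at hSk
    exact_mod_cast hSk
  have hmem : ∀ r ∈ R, periodicLift γ r = p ∧ 0 ≤ r ∧ r < 1 := fun r hrR => by
    obtain ⟨x, hx, rfl⟩ := Finset.mem_image.1 hrR
    refine ⟨?_, (AddCircle.equivIco 1 0 x).2.1, by
      simpa using (AddCircle.equivIco (1 : ℝ) 0 x).2.2⟩
    rw [periodicLift, hr]
    exact hS (hfin.mem_toFinset.1 hx)
  set f := R.orderEmbOfFin hcard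
  have hf : ∀ i, f i ∈ R := R.orderEmbOfFin_mem hcard
  -- the sorted representatives of the preimages in `[0, 1)`, closed up by the first one plus `1`
  refine ⟨fun i => if h : i < k then f ⟨i, h⟩ else f ⟨0, hk⟩ + 1, by simp [hk], fun i hi => ?_,
    fun i hi => ?_⟩
  · simp only [hi, dif_pos]
    split_ifs with h'
    · exact f.strictMono (by simp [Fin.lt_def])
    · linarith [(hmem _ (hf ⟨i, hi⟩)).2.2, (hmem _ (hf ⟨0, hk⟩)).2.1]
  · beta_reduce
    split_ifs with h'
    · exact (hmem _ (hf _)).1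
    · rw [periodicLift_periodic γ]
      exact (hmem _ (hf _)).1

theorem IsImmersedClosedCurve.exists_isImmersedVelocity
    {γ : UnitAddCircle → EuclideanSpace ℝ (Fin n)} (hγ : IsImmersedClosedCurve γ) :
    (∃ w, IsImmersedVelocity (velocity γ) w) ∧
      ∀ t, HasDerivAt (periodicLift γ) (velocity γ t) t := by
  obtain ⟨w, hw, hw2, hd, hsub⟩ := hγ.1.exists_velocity
  exact ⟨⟨w, hγ.2, hw, hw2, hsub⟩, hd⟩

/-- A point of multiplicity `k` splits the curve into `k` closed loops, and the Cauchy-Schwarz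
inequality adds up their energies. -/
theorem IsImmersedClosedCurve.varpi_mul_sq_le {γ : UnitAddCircle → EuclideanSpace ℝ (Fin n)}
    (hγ : IsImmersedClosedCurve γ) {m : ℝ} (hm : IsMStar m) {p : EuclideanSpace ℝ (Fin n)} {k : ℕ}
    (hk : 0 < k) (hp : HasPointOfMultiplicity γ p k) :
    varpi m * (k : ℝ) ^ 2 ≤ normalizedBendingEnergy γ := by
  obtain ⟨⟨w, hV⟩, hd⟩ := hγ.exists_isImmersedVelocity
  obtain ⟨t, htk, htlt, htp⟩ := hp.exists_partition hk
  set V := velocity γ with hVdef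
  have hVp : Function.Periodic V 1 := (periodicLift_periodic γ).deriv_periodic
  have hdir : Function.Periodic (direction V) 1 := fun s => by simp only [direction, hVp s]
  have hDp : Function.Periodic (bendingDensity V) 1 := fun s => by
    simp only [bendingDensity, hVp s, hdir.deriv_periodic s]
  have hNp : Function.Periodic (fun s => ‖V s‖) 1 := fun s => by simp only [hVp s]
  have hNi : ∀ a b, IntervalIntegrable (fun s => ‖V s‖) volume a b := fun a b =>
    hV.continuous.norm.intervalIntegrable a b
  have hDi := hV.intervalIntegrable_bendingDensity
  have hsum : ∀ f : ℝ → ℝ, Function.Periodic f 1 → (∀ a b, IntervalIntegrable f volume a b) →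
      ∫ s in (0 : ℝ)..1, f s = ∑ i ∈ Finset.range k, ∫ s in t i..t (i + 1), f s :=
    fun f hf hi => by
      rw [intervalIntegral.sum_integral_adjacent_intervals fun _ _ => hi _ _, htk,
        hf.intervalIntegral_add_eq (t 0) 0, zero_add]
  have hL : curveLength γ = ∑ i ∈ Finset.range k, ∫ s in t i..t (i + 1), ‖V s‖ :=
    hsum _ hNp hNi
  have hB : bendingEnergy γ = ∑ i ∈ Finset.range k, ∫ s in t i..t (i + 1), bendingDensity V s :=
    hsum _ hDp hDi
  have hL0 : ∀ i ∈ Finset.range k, 0 ≤ ∫ s in t i..t (i + 1), ‖V s‖ := fun i hi =>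
    (hV.integral_norm_pos (htlt i (Finset.mem_range.1 hi))).le
  have hB0 : ∀ i ∈ Finset.range k, 0 ≤ ∫ s in t i..t (i + 1), bendingDensity V s := fun i hi =>
    intervalIntegral.integral_nonneg (htlt i (Finset.mem_range.1 hi)).le
      fun s _ => IsImmersedVelocity.bendingDensity_nonneg V s
  rw [normalizedBendingEnergy, hL, hB]
  -- the sign of `varpi m` is not needed: for a nonpositive value the bound is trivial
  rcases le_total (varpi m) 0 with hneg | hpos
  · exact (mul_nonpos_of_nonpos_of_nonneg hneg (sq_nonneg _)).trans
      (mul_nonneg (Finset.sum_nonneg hL0) (Finset.sum_nonneg hB0))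
  have hloop : ∀ i ∈ Finset.range k, Real.sqrt (varpi m) ^ 2 ≤
      (∫ s in t i..t (i + 1), ‖V s‖) * ∫ s in t i..t (i + 1), bendingDensity V s := fun i hi => by
    have hik := Finset.mem_range.1 hi
    have hclosed : ∫ s in t i..t (i + 1), V s = 0 := by
      rw [intervalIntegral.integral_eq_sub_of_hasDerivAt (fun s _ => hd s)
        (hV.continuous.intervalIntegrable _ _), htp _ hik, htp _ hik.le, sub_self]
    have := hV.varpi_div_le_integral_bendingDensity (htlt i hik) hm hclosed
    rw [div_le_iff₀ (hV.integral_norm_pos (htlt i hik))] at this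
    rw [Real.sq_sqrt hpos, mul_comm]
    exact this
  have hCS := Finset.sum_sq_le_sum_mul_sum_of_sq_le_mul _ hL0 hB0 hloop
  rw [Finset.sum_const, Finset.card_range, nsmul_eq_mul, mul_pow, Real.sq_sqrt hpos] at hCS
  linarith

theorem theorem1p1 :
    (∃! m : ℝ, IsMStar m) ∧
      ∀ mstar : ℝ, IsMStar mstar →
        ∀ n : ℕ, 2 ≤ n → ∀ γ : UnitAddCircle → EuclideanSpace ℝ (Fin n),
          IsImmersedClosedCurve γ →
            (∀ k : ℕ, 2 ≤ k → ∀ p : EuclideanSpace ℝ (Fin n), HasPointOfMultiplicity γ p k →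
              varpi mstar * (k : ℝ) ^ 2 ≤ normalizedBendingEnergy γ) ∧
            (normalizedBendingEnergy γ < 4 * varpi mstar → Topology.IsEmbedding γ) := by
  refine ⟨existsUnique_isMStar, fun m hm n _ γ hγ =>
    ⟨fun k hk p hp => hγ.varpi_mul_sq_le hm (by omega) hp, fun hlt => ?_⟩⟩
  refine (hγ.1.1.isClosedEmbedding fun x y hxy => ?_).isEmbedding
  by_contra hne
  have hmult : HasPointOfMultiplicity γ (γ x) 2 := by
    rw [HasPointOfMultiplicity, Nat.cast_ofNat, ← encard_pair hne]
    exact encard_le_encard (by rintro z (rfl | rfl) <;> simp [hxy])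
  have := hγ.varpi_mul_sq_le hm two_pos hmult
  norm_num at this
  linarith
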